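/- Let $C=\{f:\mathbb N\to\mathbb N : f(n)\le 1 \text{ for all } n\}$ be Cantor space. For a finite sequence $\sigma$ of natural numbers let $[\sigma]$ be the set of all $g\in C$ that extend $\sigma$, and write $\overline f n=\langle f(0),\dots,f(n-1)\rangle$. For functionals $F,G:\mathbb N^{\mathbb N}\to\mathbb N$ of type two let $$\mathsf{LOC}(F,G)\;:\equiv\;(\forall f,g\in C)\bigl[g\in[\overline f\,G(f)]\rightarrow F(g)\le G(f)\bigr].$$ A weak Pincherle realiser, i.e. a realiser for the original form $\mathsf{PIT}_o$ of Pincherle's theorem ("every $F$ with $\mathsf{LOC}(F,G)$ for some $G$ is bounded on $C$"), is a type-three functional $M_o$, assigning to each pair $(F,G)$ of type-two functionals a natural number, such that $$(\forall F,G)\bigl[\mathsf{LOC}(F,G)\rightarrow(\forall f\in C)\,F(f)\le M_o(F,G)\bigr].$$ "Computable" is meant in the sense of Kleene's schemes S1--S9 over the full type structure; $M_o$ is computable in $H$ if there is an index $e$ with $M_o(F,G)=\{e\}(F,G,H)$ for all type-two $F,G$. (1) No weak Pincherle realiser is computable in any type-two functional: there are no functional $H:\mathbb N^{\mathbb N}\to\mathbb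 N$ and no weak Pincherle realiser $M_o$ such that $M_o$ is computable in $H$. (2) By contrast, finite sub-coverings of countable coverings of $C$ are computable without any functional as oracle: fix the standard effective coding of finite sequences by numbers; there is a single S1--S9 index $e$ such that, for every $s:\mathbb N\to\mathbb N$ coding a sequence $(\sigma_i)_{i\in\mathbb N}$ of finite sequences with $C\subseteq\bigcup_{i}[\sigma_i]$, the computation $\{e\}(s)$ terminates with a number $n$ such that $C\subseteq\bigcup_{i<n}[\sigma_i]$. -/

import Mathlib

namespace Pincherle

/-- The objects of pure finite type `n` in the full set-theoretic hierarchy: type `0` is `ℕ`, and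
type `n + 1` consists of all total functions from type `n` to `ℕ`. -/
@[reducible] def PureType : ℕ → Type
  | 0 => ℕ
  | n + 1 => PureType n → ℕ

/-- An argument of a computation: an object of some pure type, together with its type. -/
abbrev Arg : Type := Σ n : ℕ, PureType n

/-- A number as an argument (type 0). -/
abbrev arg0 (x : ℕ) : Arg := ⟨0, x⟩

/-- A function as an argument (type 1). -/
abbrev arg1 (f : ℕ → ℕ) : Arg := ⟨1, f⟩

/-- A type-two functional as an argument (type 2). -/
abbrev arg2 (F : (ℕ → ℕ) → ℕ) : Arg := ⟨2, F⟩

/-- Kleene's schemes S1-S9. `KleeneEval e a v` says that the computation with index `e` on the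
finite list of arguments `a` terminates with value `v`, that is, `{e}(a) = v`. It is the least
relation closed under the nine schemes; the index of a scheme carries the number of the scheme and
the indices (and other numbers) that it uses. -/
inductive KleeneEval : ℕ → List Arg → ℕ → Prop
  /-- S1, successor: `{e}(x, a) = x + 1`. -/
  | s1 (x : ℕ) (a : List Arg) :
      KleeneEval (Nat.pair 1 0) (arg0 x :: a) (x + 1)
  /-- S2, constants: `{e}(a) = q`. -/
  | s2 (q : ℕ) (a : List Arg) :
      KleeneEval (Nat.pair 2 q) a q
  /-- S3, projection: `{e}(x, a) = x`. -/
  | s3 (x : ℕ) (a : List Arg) :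
      KleeneEval (Nat.pair 3 0) (arg0 x :: a) x
  /-- S4, composition: `{e}(a) = {d}({c}(a), a)`. -/
  | s4 (c d : ℕ) (a : List Arg) (u v : ℕ) :
      KleeneEval c a u → KleeneEval d (arg0 u :: a) v →
      KleeneEval (Nat.pair 4 (Nat.pair c d)) a v
  /-- S5, primitive recursion, base case: `{e}(0, a) = {c}(a)`. -/
  | s5_zero (c d : ℕ) (a : List Arg) (v : ℕ) :
      KleeneEval c a v →
      KleeneEval (Nat.pair 5 (Nat.pair c d)) (arg0 0 :: a) v
  /-- S5, primitive recursion, step: `{e}(x + 1, a) = {d}(x, {e}(x, a), a)`. -/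
  | s5_succ (c d x : ℕ) (a : List Arg) (u v : ℕ) :
      KleeneEval (Nat.pair 5 (Nat.pair c d)) (arg0 x :: a) u →
      KleeneEval d (arg0 x :: arg0 u :: a) v →
      KleeneEval (Nat.pair 5 (Nat.pair c d)) (arg0 (x + 1) :: a) v
  /-- S6, permutation of the arguments: `{e}(a) = {d}(a')`, where `a'` is `a` with the argument
  number `k` (counted from `0`) moved to the front. -/
  | s6 (k d : ℕ) (a : List Arg) (t : Arg) (v : ℕ) :
      a[k]? = some t → KleeneEval d (t :: a.eraseIdx k) v →
      KleeneEval (Nat.pair 6 (Nat.pair k d)) a v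
  /-- S7, application of a function: `{e}(f, x, a) = f(x)`. -/
  | s7 (f : ℕ → ℕ) (x : ℕ) (a : List Arg) :
      KleeneEval (Nat.pair 7 0) (arg1 f :: arg0 x :: a) (f x)
  /-- S8, application of a functional of type `k + 2`:
  `{e}(φ, a) = φ(λ β. {d}(β, φ, a))` with `β` of type `k`, provided that `{d}(β, φ, a)` is defined
  for all `β`. -/
  | s8 (d k : ℕ) (φ : PureType (k + 2)) (a : List Arg) (g : PureType (k + 1)) :
      (∀ β : PureType k, KleeneEval d (⟨k, β⟩ :: ⟨k + 2, φ⟩ :: a) (g β)) →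
      KleeneEval (Nat.pair 8 d) (⟨k + 2, φ⟩ :: a) (φ g)
  /-- S9, enumeration (the index is an argument): `{e}(x, b) = {x}(b')`, where `b'` consists of the
  first `m` arguments in the list `b`. -/
  | s9 (m x : ℕ) (b : List Arg) (v : ℕ) :
      m ≤ b.length → KleeneEval x (b.take m) v →
      KleeneEval (Nat.pair 9 m) (arg0 x :: b) v

/-- The total type-three functional `M`, with two arguments of type two, is computable (S1-S9) in
the type-two functional `H`: for one index `e`, `M(F, G) = {e}(F, G, H)` for all `F`, `G`. -/
def ComputableIn (M : ((ℕ → ℕ) → ℕ) → ((ℕ → ℕ) → ℕ) → ℕ) (H : (ℕ → ℕ) → ℕ) : Prop :=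
  ∃ e : ℕ, ∀ F G : (ℕ → ℕ) → ℕ, KleeneEval e [arg2 F, arg2 G, arg2 H] (M F G)

/-- Cantor space `C`: the functions `f ≤ 1`. -/
def Cantor : Set (ℕ → ℕ) := {f | ∀ n, f n ≤ 1}

/-- The initial segment `⟨f(0), …, f(n-1)⟩` of `f`. -/
def initSeg (f : ℕ → ℕ) (n : ℕ) : List ℕ := (List.range n).map f

/-- `[σ]`: the binary sequences that extend the finite sequence `σ`. -/
def nbhd (σ : List ℕ) : Set (ℕ → ℕ) :=
  {g | g ∈ Cantor ∧ initSeg g σ.length = σ}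

/-- `LOC(F, G)`: `G` is a realiser for the local boundedness of `F` on Cantor space. -/
def LOC (F G : (ℕ → ℕ) → ℕ) : Prop :=
  ∀ f ∈ Cantor, ∀ g ∈ Cantor, g ∈ nbhd (initSeg f (G f)) → F g ≤ G f

/-- `WPR(M)`: `M` is a weak Pincherle realiser. -/
def WPR (M : ((ℕ → ℕ) → ℕ) → ((ℕ → ℕ) → ℕ) → ℕ) : Prop :=
  ∀ F G : (ℕ → ℕ) → ℕ, LOC F G → ∀ f ∈ Cantor, F f ≤ M F G

/-- The `i`-th basic open set of the sequence coded by `s`: the neighbourhood of the finite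
sequence with code `s i`, under the standard effective bijection of `ℕ` with `List ℕ`. -/
def coverSet (s : ℕ → ℕ) (i : ℕ) : Set (ℕ → ℕ) := nbhd (Denumerable.ofNat (List ℕ) (s i))

end Pincherle

namespace Pincherle

/-! For (1), fix `H`. Zorn's lemma gives a maximal partial functional `R` whose value at `f` is one
plus the code of a computation of `f` from `R` itself and `H`. The code determines `f`, so `R` is
injective; by maximality its domain contains every function computable relative to it. Hence S8
queries `F` and `G` only where `R` fixes them, and a computation cannot distinguish two pairs
extending `R` (`partialEval_of_maximal`). Injectivity also leaves room to diagonalise: some `g ∈ C`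
avoids every neighbourhood prescribed by `R` (`exists_cantor_notMem_nbhd`). If `N` is the value of
`M` on one extension, another one with `F g = N + 1` satisfies `LOC` but receives the same bound
`N`.

For (2), whether the first `n` neighbourhoods of length at most `n` cover `C` is a primitive
recursive test on binary words of length `n`. Compactness of `C` makes a search over `n` succeed;
the search is programmed with S9 by passing an index to itself. -/

/-- The value of a computation is unique. -/
theorem KleeneEval.unique {e : ℕ} {a : List Arg} {v w : ℕ} (h : KleeneEval e a v)
    (h' : KleeneEval e a w) : v = w := by
  induction h generalizing w with
  | s1 x a => 
    generalize hb : arg0 x :: a = b at h'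
    generalize he : Nat.pair 1 0 = e at h'
    cases h' <;> simp_all [Nat.pair_eq_pair]
  | s2 q a =>
    generalize he : Nat.pair 2 q = e at h'
    cases h' <;> simp_all [Nat.pair_eq_pair]
  | s3 x a =>
    generalize hb : arg0 x :: a = b at h'
    generalize he : Nat.pair 3 0 = e at h'
    cases h' <;> simp_all [Nat.pair_eq_pair]
  | s4 c d a u v _ _ ih1 ih2 =>
    generalize he : Nat.pair 4 (Nat.pair c d) = e at h'
    cases h' <;> simp only [Nat.pair_eq_pair] at he <;> try omega
    obtain ⟨-, rfl, rfl⟩ := he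
    rename_i h1 h2
    obtain rfl := ih1 h1
    exact ih2 h2
  | s5_zero c d a v _ ih =>
    generalize he : Nat.pair 5 (Nat.pair c d) = e at h'
    generalize hb : arg0 0 :: a = b at h'
    cases h' <;> simp only [Nat.pair_eq_pair] at he <;> try omega
    · obtain ⟨-, rfl, rfl⟩ := he
      obtain ⟨-, rfl⟩ := List.cons.inj hb
      rename_i h1
      exact ih h1
    · simp at hb
  | s5_succ c d x a u v _ _ ih1 ih2 =>
    generalize he : Nat.pair 5 (Nat.pair c d) = e at h'
    generalize hb : arg0 (x + 1) :: a = b at h'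
    cases h' <;> simp only [Nat.pair_eq_pair] at he <;> try omega
    · simp at hb
    · obtain ⟨-, rfl, rfl⟩ := he
      obtain ⟨hx, rfl⟩ := List.cons.inj hb
      simp only [arg0, Sigma.mk.injEq, heq_eq_eq, true_and, Nat.add_right_cancel_iff] at hx
      subst hx
      rename_i h2 h1
      obtain rfl := ih1 h1
      exact ih2 h2
  | s6 k d a t v hk _ ih =>
    generalize he : Nat.pair 6 (Nat.pair k d) = e at h'
    cases h' <;> simp only [Nat.pair_eq_pair] at he <;> try omega
    obtain ⟨-, rfl, rfl⟩ := he
    rename_i h1 h2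
    obtain rfl := Option.some.inj (hk.symm.trans h1)
    exact ih h2
  | s7 f x a =>
    generalize hb : arg1 f :: arg0 x :: a = b at h'
    generalize he : Nat.pair 7 0 = e at h'
    cases h' <;> simp only [Nat.pair_eq_pair] at he <;> try omega
    simp only [List.cons.injEq, Sigma.mk.injEq, heq_eq_eq, true_and] at hb
    rw [hb.1, hb.2.1]
  | s8 d k φ a g _ ih =>
    generalize he : Nat.pair 8 d = e at h'
    generalize hb : (⟨k + 2, φ⟩ : Arg) :: a = b at h'
    cases h' <;> simp only [Nat.pair_eq_pair] at he <;> try omega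
    rename_i d' k' φ' a' g' h1
    obtain ⟨-, rfl⟩ := he
    obtain ⟨h, rfl⟩ := List.cons.inj hb
    obtain ⟨hk, h⟩ := Sigma.mk.inj h
    obtain rfl : k = k' := by omega
    obtain rfl := eq_of_heq h
    exact congrArg φ (funext fun β => ih β (h1 β))
  | s9 m x b v _ _ ih =>
    generalize he : Nat.pair 9 m = e at h'
    generalize hb : arg0 x :: b = b' at h'
    cases h' <;> simp only [Nat.pair_eq_pair] at he <;> try omega
    obtain ⟨-, rfl⟩ := he
    rename_i h1
    obtain ⟨hx, rfl⟩ := List.cons.inj hb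
    simp only [arg0, Sigma.mk.injEq, heq_eq_eq, true_and] at hx
    subst hx
    exact ih h1

/-! ### Maximal self-indexed partial functionals -/

/-- The arguments denoted by symbols: `inl x` stands for the number `x`, and `inr i` for the
`i`-th of three functionals of type two. -/
def interp (F G H : (ℕ → ℕ) → ℕ) : ℕ ⊕ Fin 3 → Arg :=
  Sum.elim arg0 fun i => arg2 (![F, G, H] i)

/-- `F` and `G` extend the partial functional with graph `R` and the zero functional on its
domain. -/
def Extends (R : Set ((ℕ → ℕ) × ℕ)) (F G : (ℕ → ℕ) → ℕ) : Prop :=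
  ∀ p ∈ R, F p.1 = 0 ∧ G p.1 = p.2

/-- The computation terminates with the same value `v` for all `F` and `G` that extend `R`. -/
def PartialEval (H : (ℕ → ℕ) → ℕ) (R : Set ((ℕ → ℕ) × ℕ)) (e : ℕ) (b : List (ℕ ⊕ Fin 3))
    (v : ℕ) : Prop :=
  ∀ F G, Extends R F G → KleeneEval e (b.map (interp F G H)) v

theorem Extends.mono {R S : Set ((ℕ → ℕ) × ℕ)} (h : R ⊆ S) {F G : (ℕ → ℕ) → ℕ}
    (hS : Extends S F G) : Extends R F G := fun p hp => hS p (h hp)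

theorem PartialEval.mono {H : (ℕ → ℕ) → ℕ} {R S : Set ((ℕ → ℕ) × ℕ)} (h : R ⊆ S) {e : ℕ}
    {b : List (ℕ ⊕ Fin 3)} {v : ℕ} (hR : PartialEval H R e b v) : PartialEval H S e b v :=
  fun F G hS => hR F G (hS.mono h)

/-- The graphs of partial functionals whose value at `f` is one more than the code of a
computation of `f` relative to the partial functional itself. -/
structure SelfIndexed (H : (ℕ → ℕ) → ℕ) (R : Set ((ℕ → ℕ) × ℕ)) : Prop where
  functional : ∀ f m n, (f, m) ∈ R → (f, n) ∈ R → m = n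
  index : ∀ f n, (f, n) ∈ R → ∃ (d : ℕ) (b : List (ℕ ⊕ Fin 3)),
    n = Encodable.encode (d, b) + 1 ∧ ∀ x, PartialEval H R d (Sum.inl x :: b) (f x)

open Classical in
/-- The total functional that takes the values prescribed by `R`, and the value `c` elsewhere. -/
noncomputable def extendBy (R : Set ((ℕ → ℕ) × ℕ)) (c : ℕ) (f : ℕ → ℕ) : ℕ :=
  if h : ∃ n, (f, n) ∈ R then h.choose else c

theorem SelfIndexed.extendBy_eq {H : (ℕ → ℕ) → ℕ} {R : Set ((ℕ → ℕ) × ℕ)} (hR : SelfIndexed H R)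
    (c : ℕ) {f : ℕ → ℕ} {n : ℕ} (h : (f, n) ∈ R) : extendBy R c f = n := by
  have h' : ∃ n, (f, n) ∈ R := ⟨n, h⟩
  rw [extendBy, dif_pos h']
  exact hR.functional _ _ _ h'.choose_spec h

/-- A value decodes to one computation, and computations are single-valued. -/
theorem SelfIndexed.injective {H : (ℕ → ℕ) → ℕ} {R : Set ((ℕ → ℕ) × ℕ)} (hR : SelfIndexed H R)
    {f g : ℕ → ℕ} {n : ℕ} (hf : (f, n) ∈ R) (hg : (g, n) ∈ R) : f = g := by
  obtain ⟨d, b, hn, hd⟩ := hR.index f n hf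
  obtain ⟨d', b', hn', hd'⟩ := hR.index g n hg
  have : (d, b) = (d', b') := Encodable.encode_injective (by omega)
  obtain ⟨rfl, rfl⟩ := Prod.mk.inj this
  -- `PartialEval` quantifies over total extensions, so one must be exhibited before uniqueness
  -- applies.
  have hE : Extends R (fun _ => 0) (extendBy R 0) := fun p hp => ⟨rfl, hR.extendBy_eq 0 hp⟩
  exact funext fun x => (hd x _ _ hE).unique (hd' x _ _ hE)

/-- Unions of chains stay self-indexed because a larger graph has fewer extensions, so `PartialEval`
persists. -/
theorem exists_maximal_selfIndexed (H : (ℕ → ℕ) → ℕ) :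
    ∃ R, Maximal (· ∈ {R | SelfIndexed H R}) R := by
  refine zorn_subset _ fun c hc hchain => ⟨⋃₀ c, ⟨?_, ?_⟩, fun s => Set.subset_sUnion_of_mem⟩
  · rintro f m n ⟨s, hs, hm⟩ ⟨t, ht, hn⟩
    rcases hchain.total hs ht with h | h
    · exact (hc ht).functional f m n (h hm) hn
    · exact (hc hs).functional f m n hm (h hn)
  · rintro f n ⟨s, hs, hn⟩
    obtain ⟨d, b, h, hd⟩ := (hc hs).index f n hn
    exact ⟨d, b, h, fun x => (hd x).mono (Set.subset_sUnion_of_mem hs)⟩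

/-- The domain of a maximal self-indexed graph contains the functions computable relative to it. -/
theorem exists_mem_of_maximal {H : (ℕ → ℕ) → ℕ} {R : Set ((ℕ → ℕ) × ℕ)}
    (hR : Maximal (· ∈ {R | SelfIndexed H R}) R) {f : ℕ → ℕ} {d : ℕ} {b : List (ℕ ⊕ Fin 3)}
    (hf : ∀ x, PartialEval H R d (Sum.inl x :: b) (f x)) : ∃ n, (f, n) ∈ R := by
  by_contra hn
  push Not at hn
  set p := (f, Encodable.encode (d, b) + 1) with hp
  have hsub : R ⊆ insert p R := Set.subset_insert _ _
  -- The new value codes a computation that already works over `R`, hence also over the enlarged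
  -- graph.
  have hS : SelfIndexed H (insert p R) := by
    refine ⟨fun g m n hm hm' => ?_, fun g n hg => ?_⟩
    · rcases hm with hm | hm <;> rcases hm' with hm' | hm'
      · rw [hp, Prod.mk.injEq] at hm hm'
        rw [hm.2, hm'.2]
      · rw [hp, Prod.mk.injEq] at hm
        exact absurd (hm.1 ▸ hm') (hn n)
      · rw [hp, Prod.mk.injEq] at hm'
        exact absurd (hm'.1 ▸ hm) (hn m)
      · exact hR.prop.functional g m n hm hm'
    · rcases hg with hg | hg
      · rw [hp, Prod.mk.injEq] at hg
        exact ⟨d, b, hg.2, fun x => hg.1 ▸ (hf x).mono hsub⟩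
      · obtain ⟨d, b, h, hd⟩ := hR.prop.index g n hg
        exact ⟨d, b, h, fun x => (hd x).mono hsub⟩
  exact hn _ (hR.le_of_ge hS hsub (Set.mem_insert p R))

theorem eq_cons_of_cons_eq_map {α β : Type*} {f : α → β} {t : β} {a : List β} {b : List α}
    (h : t :: a = b.map f) : ∃ s c, b = s :: c ∧ t = f s ∧ a = c.map f := by
  obtain ⟨s, c, rfl, h1, h2⟩ := List.map_eq_cons_iff.1 h.symm
  exact ⟨s, c, rfl, h1.symm, h2.symm⟩

theorem interp_eq_arg0 {F G H : (ℕ → ℕ) → ℕ} {s : ℕ ⊕ Fin 3} {x : ℕ}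
    (h : arg0 x = interp F G H s) : s = Sum.inl x := by
  rcases s with y | i
  · simp only [interp, Sum.elim_inl, Sigma.mk.injEq, heq_eq_eq, true_and] at h
    rw [h]
  · simp [interp] at h

/-- A computation that terminates for one extension of a maximal self-indexed graph terminates
with the same value for all extensions. -/
theorem partialEval_of_maximal {H : (ℕ → ℕ) → ℕ} {R : Set ((ℕ → ℕ) × ℕ)}
    (hR : Maximal (· ∈ {R | SelfIndexed H R}) R) {F G : (ℕ → ℕ) → ℕ} (hE : Extends R F G)
    {e : ℕ} {a : List Arg} {v : ℕ} (h : KleeneEval e a v) :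
    ∀ b, a = b.map (interp F G H) → PartialEval H R e b v := by
  induction h with
  | s1 x a =>
    intro b hb F' G' hE'
    obtain ⟨s, c, rfl, hs, rfl⟩ := eq_cons_of_cons_eq_map hb
    obtain rfl := interp_eq_arg0 hs
    exact .s1 x _
  | s2 q a => intro b hb F' G' hE'; exact .s2 q _
  | s3 x a =>
    intro b hb F' G' hE'
    obtain ⟨s, c, rfl, hs, rfl⟩ := eq_cons_of_cons_eq_map hb
    obtain rfl := interp_eq_arg0 hs
    exact .s3 x _
  | s4 c d a u v _ _ ih1 ih2 =>
    intro b hb F' G' hE'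
    exact .s4 c d _ u v (ih1 b hb F' G' hE')
      (ih2 (Sum.inl u :: b) (by rw [hb]; rfl) F' G' hE')
  | s5_zero c d a v _ ih =>
    intro b hb F' G' hE'
    obtain ⟨s, b, rfl, hs, rfl⟩ := eq_cons_of_cons_eq_map hb
    obtain rfl := interp_eq_arg0 hs
    exact .s5_zero c d _ v (ih b rfl F' G' hE')
  | s5_succ c d x a u v _ _ ih1 ih2 =>
    intro b hb F' G' hE'
    obtain ⟨s, b, rfl, hs, rfl⟩ := eq_cons_of_cons_eq_map hb
    obtain rfl := interp_eq_arg0 hs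
    exact .s5_succ c d x _ u v (ih1 (Sum.inl x :: b) rfl F' G' hE')
      (ih2 (Sum.inl x :: Sum.inl u :: b) rfl F' G' hE')
  | s6 k d a t v hk _ ih =>
    intro b hb F' G' hE'
    subst hb
    rw [List.getElem?_map, Option.map_eq_some_iff] at hk
    obtain ⟨s, hs, rfl⟩ := hk
    refine .s6 k d _ (interp F' G' H s) v (by rw [List.getElem?_map, hs]; rfl) ?_
    have := ih (s :: b.eraseIdx k) (by rw [List.map_cons, List.eraseIdx_map]) F' G' hE'
    rwa [List.map_cons, ← List.eraseIdx_map] at this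
  | s7 f x a =>
    intro b hb
    obtain ⟨s, b, rfl, hs, -⟩ := eq_cons_of_cons_eq_map hb
    -- Only numbers and type-two functionals occur as arguments, so S7 never applies.
    rcases s with y | i <;> simp [interp] at hs
  | s8 d k φ a g _ ih =>
    intro b hb F' G' hE'
    obtain ⟨s, b, rfl, hs, rfl⟩ := eq_cons_of_cons_eq_map hb
    rcases s with y | i
    · simp [interp] at hs
    · obtain ⟨hk, hφ⟩ := Sigma.mk.inj hs
      obtain rfl : k = 0 := by omega
      obtain rfl := eq_of_heq hφ
      have hg : ∀ x, PartialEval H R d (Sum.inl x :: Sum.inr i :: b) (g x) :=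
        fun x => ih x (Sum.inl x :: Sum.inr i :: b) rfl
      -- The function queried is itself computable relative to `R`, so maximality puts it in the
      -- domain and all extensions give the same answer.
      obtain ⟨n, hn⟩ := exists_mem_of_maximal hR hg
      have key : ![F, G, H] i g = ![F', G', H] i g := by
        have h1 := hE _ hn
        have h2 := hE' _ hn
        fin_cases i
        · exact h1.1.trans h2.1.symm
        · exact h1.2.trans h2.2.symm
        · rfl
      rw [key]
      exact .s8 d 0 (![F', G', H] i) _ g fun x => hg x F' G' hE'
  | s9 m x b v hm _ ih =>
    intro b' hb F' G' hE'
    obtain ⟨s, b, rfl, hs, rfl⟩ := eq_cons_of_cons_eq_map hb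
    obtain rfl := interp_eq_arg0 hs
    refine .s9 m x _ v (by simpa using hm) ?_
    have := ih (b.take m) (by rw [List.map_take]) F' G' hE'
    rwa [List.map_take] at this

/-! ### Diagonalisation against a weak Pincherle realiser -/

theorem apply_eq_of_mem_nbhd {f g : ℕ → ℕ} {n k : ℕ} (h : g ∈ nbhd (initSeg f n)) (hk : k < n) :
    g k = f k := by
  have h' := h.2
  simp only [initSeg, List.length_map, List.length_range] at h'
  exact List.map_inj_left.1 h' k (List.mem_range.2 hk)

/-- If at most one element of Cantor space is assigned each positive length, then the
neighbourhoods of these lengths do not cover Cantor space. -/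
theorem exists_cantor_notMem_nbhd {R : Set ((ℕ → ℕ) × ℕ)} (hpos : ∀ f n, (f, n) ∈ R → 0 < n)
    (hinj : ∀ f g n, (f, n) ∈ R → (g, n) ∈ R → f = g) :
    ∃ g ∈ Cantor, ∀ f n, f ∈ Cantor → (f, n) ∈ R → g ∉ nbhd (initSeg f n) := by
  classical
  -- Digit `k` is reserved for the unique `f` with value `k + 1`: it is the last digit of that
  -- initial segment, so flipping it leaves the neighbourhood.
  refine ⟨fun k => if h : ∃ f, (f, k + 1) ∈ R then 1 - h.choose k else 0, fun k => ?_,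
    fun f n hf hn hg => ?_⟩
  · dsimp only
    split_ifs <;> omega
  · obtain ⟨k, rfl⟩ : ∃ k, n = k + 1 := ⟨n - 1, by have := hpos f n hn; omega⟩
    have h := apply_eq_of_mem_nbhd hg (Nat.lt_succ_self k)
    have h' : ∃ f, (f, k + 1) ∈ R := ⟨f, hn⟩
    rw [dif_pos h', hinj _ _ _ h'.choose_spec hn] at h
    have := hf k
    omega

/-- No weak Pincherle realiser is computable in a functional of type two. -/
theorem not_computableIn_of_wpr {H : (ℕ → ℕ) → ℕ} {M : ((ℕ → ℕ) → ℕ) → ((ℕ → ℕ) → ℕ) → ℕ}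
    (hM : WPR M) : ¬ ComputableIn M H := by
  classical
  rintro ⟨e, he⟩
  obtain ⟨R, hR⟩ := exists_maximal_selfIndexed H
  have hRS : SelfIndexed H R := hR.prop
  obtain ⟨g, hg, hgR⟩ := exists_cantor_notMem_nbhd (R := R)
    (fun f n h => by obtain ⟨d, b, rfl, -⟩ := hRS.index f n h; omega)
    (fun f f' n h h' => hRS.injective h h')
  set N := M (fun _ => 0) (extendBy R 0)
  -- Off the domain of `R`, the default `N + 1` already bounds `F`; on the domain, `g` is outside
  -- the neighbourhood and `F` vanishes there.
  set G := extendBy R (N + 1)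
  set F : (ℕ → ℕ) → ℕ := fun h => if h = g then N + 1 else 0
  have hmem : ∀ f ∈ Cantor, ∀ n, (f, n) ∈ R → f ≠ g := by
    rintro f hf n hn rfl
    exact hgR f n hf hn ⟨hf, by simp [initSeg]⟩
  have hE : Extends R F G := fun p hp =>
    ⟨if_neg fun h : p.1 = g => hmem g hg p.2 (by rwa [← h]) rfl, hRS.extendBy_eq _ hp⟩
  have hE₀ : Extends R (fun _ => 0) (extendBy R 0) := fun p hp => ⟨rfl, hRS.extendBy_eq 0 hp⟩
  have hN : M F G = N :=
    (he F G).unique (partialEval_of_maximal hR hE₀ (he _ _) [.inr 0, .inr 1, .inr 2] rfl F G hE)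
  have hloc : LOC F G := by
    intro f hf h _ hh
    by_cases hfR : ∃ n, (f, n) ∈ R
    · obtain ⟨n, hn⟩ := hfR
      have hGf : G f = n := hRS.extendBy_eq _ hn
      have hne : h ≠ g := by
        rintro rfl
        exact hgR f n hf hn (hGf ▸ hh)
      simp [F, hne]
    · have hGf : G f = N + 1 := dif_neg hfR
      rw [hGf]
      dsimp only [F]
      split_ifs <;> omega
  have := hM F G hloc g hg
  rw [hN] at this
  simp [F] at this

/-! ### Primitive recursive functions in S1-S9 -/

/-- The index `e` computes `f` from the arguments at the positions given by `pos`. -/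
def ComputesAt {n : ℕ} (f : List.Vector ℕ n → ℕ) (pos : Fin n → ℕ) (e : ℕ) : Prop :=
  ∀ (b : List Arg) (v : List.Vector ℕ n), (∀ i, b[pos i]? = some (arg0 (v.get i))) →
    KleeneEval e b (f v)

/-- The index of the projection to the argument number `k`. -/
def projIndex (k : ℕ) : ℕ := Nat.pair 6 (Nat.pair k (Nat.pair 3 0))

/-- The index of the successor of the argument number `k`. -/
def succIndex (k : ℕ) : ℕ := Nat.pair 6 (Nat.pair k (Nat.pair 1 0))

/-- The index of the composition `{d}({c}(a), a)`. -/
def compIndex (c d : ℕ) : ℕ := Nat.pair 4 (Nat.pair c d)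

theorem kleeneEval_projIndex {k x : ℕ} {b : List Arg} (h : b[k]? = some (arg0 x)) :
    KleeneEval (projIndex k) b x :=
  .s6 _ _ _ _ _ h (.s3 _ _)

theorem kleeneEval_succIndex {k x : ℕ} {b : List Arg} (h : b[k]? = some (arg0 x)) :
    KleeneEval (succIndex k) b (x + 1) :=
  .s6 _ _ _ _ _ h (.s1 _ _)

theorem kleeneEval_compIndex {c d u v : ℕ} {b : List Arg} (hc : KleeneEval c b u)
    (hd : KleeneEval d (arg0 u :: b) v) : KleeneEval (compIndex c d) b v :=
  .s4 _ _ _ _ _ hc hd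

/-- Several values can be computed one after the other and put in front of the arguments. -/
theorem exists_computesAt_push {m : ℕ} (pos : Fin m → ℕ) {l : ℕ}
    (g : Fin l → List.Vector ℕ m → ℕ)
    (hg : ∀ (i : Fin l) (pos : Fin m → ℕ), ∃ e, ComputesAt (g i) pos e) (d : ℕ) :
    ∃ e, ∀ (b : List Arg) (v : List.Vector ℕ m) (w : ℕ),
      (∀ i, b[pos i]? = some (arg0 (v.get i))) →
      KleeneEval d ((List.ofFn fun i => arg0 (g i v)) ++ b) w → KleeneEval e b w := by
  induction l generalizing d with
  | zero => exact ⟨d, fun b v w _ h => by simpa using h⟩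
  | succ l ih =>
    -- The first value is computed last, when `l` others already precede the original arguments.
    obtain ⟨c, hc⟩ := hg 0 fun i => pos i + l
    obtain ⟨e, he⟩ := ih (fun i => g i.succ) (fun i => hg i.succ) (compIndex c d)
    refine ⟨e, fun b v w hb h => he b v w hb (kleeneEval_compIndex (hc _ v fun i => ?_) ?_)⟩
    · rw [List.getElem?_append_right (by simp)]
      simpa using hb i
    · rw [List.ofFn_succ] at h
      exact h

/-- Primitive recursive functions are computable by S1-S6. -/
theorem exists_computesAt {n : ℕ} {f : List.Vector ℕ n → ℕ} (hf : Nat.Primrec' f) :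
    ∀ pos : Fin n → ℕ, ∃ e, ComputesAt f pos e := by
  induction hf with
  | zero => exact fun pos => ⟨_, fun b v _ => .s2 0 b⟩
  | succ =>
    exact fun pos => ⟨succIndex (pos 0), fun b v h => kleeneEval_succIndex
      (by simpa using h 0)⟩
  | get i => exact fun pos => ⟨projIndex (pos i), fun b v h => kleeneEval_projIndex (h i)⟩
  | @comp m l f g _ _ ihf ihg =>
    intro pos
    obtain ⟨d, hd⟩ := ihf fun i => i
    obtain ⟨e, he⟩ := exists_computesAt_push pos g ihg d
    refine ⟨e, fun b v h => he b v _ h (hd _ _ fun i => ?_)⟩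
    rw [List.getElem?_append_left (by simp)]
    simp
  | @prec n f g _ _ ihf ihg =>
    intro pos
    obtain ⟨c, hc⟩ := ihf fun i => pos i.succ
    -- The step of S5 sees the counter and the previous value in front of the whole list `b`, hence
    -- the shift by `2`.
    obtain ⟨d, hd⟩ := ihg (Fin.cons 0 (Fin.cons 1 fun i => pos i.succ + 2))
    refine ⟨compIndex (projIndex (pos 0)) (Nat.pair 5 (Nat.pair c d)), fun b v h => ?_⟩
    refine kleeneEval_compIndex (u := v.head) (kleeneEval_projIndex (by simpa using h 0)) ?_
    have ht : ∀ i, b[pos i.succ]? = some (arg0 (v.tail.get i)) := fun i => by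
      simpa using h i.succ
    dsimp only
    induction v.head with
    | zero => exact .s5_zero _ _ _ _ (hc _ _ ht)
    | succ x ih =>
      refine .s5_succ _ _ _ _ _ _ ih (hd _ _ fun i => ?_)
      refine Fin.cases ?_ (fun i => Fin.cases ?_ (fun i => ?_) i) i
      · simp
      · simp only [Fin.cons_succ, Fin.cons_zero, List.Vector.get_cons_succ,
          List.Vector.get_zero, List.Vector.head_cons]
        rfl
      · simpa using ht i

theorem exists_index_of_primrec₂ {f : ℕ → ℕ → ℕ} (hf : Primrec₂ f) (i j : ℕ) :
    ∃ e, ∀ (b : List Arg) (x y : ℕ), b[i]? = some (arg0 x) → b[j]? = some (arg0 y) →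
      KleeneEval e b (f x y) := by
  have h : Nat.Primrec' fun v : List.Vector ℕ 2 => f (v.get 0) (v.get 1) :=
    .of_prim (hf.comp (Primrec.vector_get.comp .id (.const 0))
      (Primrec.vector_get.comp .id (.const 1)))
  obtain ⟨e, he⟩ := exists_computesAt h ![i, j]
  refine ⟨e, fun b x y hx hy => he b (x ::ᵥ y ::ᵥ .nil) fun k => ?_⟩
  fin_cases k
  · exact hx
  · exact hy

/-! ### Unbounded search by self-application -/

/-- The list `s (n - 1), …, s 0`. -/
def reverseSeg (s : ℕ → ℕ) : ℕ → List ℕ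
  | 0 => []
  | n + 1 => s n :: reverseSeg s n

theorem mem_reverseSeg {s : ℕ → ℕ} {n x : ℕ} : x ∈ reverseSeg s n ↔ ∃ i < n, s i = x := by
  induction n with
  | zero => simp [reverseSeg]
  | succ n ih =>
    rw [reverseSeg, List.mem_cons, ih]
    constructor
    · rintro (rfl | ⟨i, hi, rfl⟩)
      · exact ⟨n, by omega, rfl⟩
      · exact ⟨i, by omega, rfl⟩
    · rintro ⟨i, hi, rfl⟩
      rcases Nat.lt_succ_iff_lt_or_eq.1 hi with h | rfl
      · exact .inr ⟨i, h, rfl⟩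
      · exact .inl rfl

/-- The spare argument `y` makes room for the index that the search carries along. -/
theorem exists_index_reverseSeg : ∃ e, ∀ (s : ℕ → ℕ) (n y : ℕ) (b : List Arg),
    KleeneEval e (arg0 n :: arg0 y :: arg1 s :: b) (Encodable.encode (reverseSeg s n)) := by
  obtain ⟨d, hd⟩ := exists_index_of_primrec₂ (f := fun x y => Nat.succ (Nat.pair x y))
    (Primrec.succ.comp₂ Primrec₂.natPair) 0 2
  refine ⟨Nat.pair 5 (Nat.pair (Nat.pair 2 0)
    (compIndex (Nat.pair 6 (Nat.pair 3 (Nat.pair 7 0))) d)), fun s n y b => ?_⟩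
  induction n with
  | zero => exact .s5_zero _ _ _ _ (.s2 _ _)
  | succ n ih =>
    refine .s5_succ _ _ _ _ _ _ ih (kleeneEval_compIndex (u := s n) ?_ ?_)
    · exact .s6 _ _ _ (arg1 s) _ rfl (.s7 _ _ _)
    · exact hd _ _ _ rfl rfl

/-- Unbounded search is computable: an index for the search for the least `n` such that the
primitive recursive test `t` vanishes at `n` and at the code of the first `n` values of `s`. -/
theorem exists_index_search {t : ℕ → ℕ → ℕ} (ht : Primrec₂ t) : ∃ e, ∀ s : ℕ → ℕ,
    (∃ n, t n (Encodable.encode (reverseSeg s n)) = 0) →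
    ∃ n, t n (Encodable.encode (reverseSeg s n)) = 0 ∧ KleeneEval e [arg1 s] n := by
  obtain ⟨h, hh⟩ := exists_index_reverseSeg
  obtain ⟨c, hc⟩ := exists_index_of_primrec₂ ht 1 0
  -- On `[x, u, w, n, q, s]`, `r` builds a list beginning `q, n + 1, q, s`, and S9 runs `q` on `[n +
  -- 1, q, s]`. In `p`, S5 acts as a conditional on the test value: zero returns `n`, and otherwise
  -- every step calls `r`, ignoring `x` and `u`.
  let r := Nat.pair 6 (Nat.pair 5 (compIndex (projIndex 5) (compIndex (succIndex 5)
    (compIndex (projIndex 1) (Nat.pair 9 3)))))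
  let p := Nat.pair 5 (Nat.pair (projIndex 1) r)
  let q := compIndex h (compIndex c p)
  refine ⟨compIndex (Nat.pair 2 q) (compIndex (Nat.pair 2 0) q), fun s ⟨N, hN⟩ => ?_⟩
  -- Induction on the distance `j` to a known zero of the test proves termination.
  have search : ∀ j n, t (n + j) (Encodable.encode (reverseSeg s (n + j))) = 0 →
      ∃ m, t m (Encodable.encode (reverseSeg s m)) = 0 ∧
        KleeneEval q [arg0 n, arg0 q, arg1 s] m := by
    intro j
    induction j with
    | zero =>
      intro n hn
      rw [Nat.add_zero] at hn
      refine ⟨n, hn, kleeneEval_compIndex (hh s n q []) (kleeneEval_compIndex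
        (hc _ n (Encodable.encode (reverseSeg s n)) rfl rfl) ?_)⟩
      rw [hn]
      exact .s5_zero _ _ _ _ (kleeneEval_projIndex rfl)
    | succ j ih =>
      intro n hn
      obtain ⟨m, hm, hqm⟩ := ih (n + 1) (by rwa [Nat.add_right_comm, Nat.add_assoc])
      by_cases h0 : t n (Encodable.encode (reverseSeg s n)) = 0
      · refine ⟨n, h0, kleeneEval_compIndex (hh s n q []) (kleeneEval_compIndex
          (hc _ n (Encodable.encode (reverseSeg s n)) rfl rfl) ?_)⟩
        rw [h0]
        exact .s5_zero _ _ _ _ (kleeneEval_projIndex rfl)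
      · obtain ⟨k, hk⟩ := Nat.exists_eq_succ_of_ne_zero h0
        refine ⟨m, hm, kleeneEval_compIndex (hh s n q []) (kleeneEval_compIndex
          (hc _ n (Encodable.encode (reverseSeg s n)) rfl rfl) ?_)⟩
        rw [hk]
        have hr : ∀ x u w : ℕ,
            KleeneEval r [arg0 x, arg0 u, arg0 w, arg0 n, arg0 q, arg1 s] m := fun x u w =>
          .s6 _ _ _ (arg1 s) _ rfl (kleeneEval_compIndex (u := q) (kleeneEval_projIndex rfl)
            (kleeneEval_compIndex (u := n + 1) (kleeneEval_succIndex rfl)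
              (kleeneEval_compIndex (u := q) (kleeneEval_projIndex rfl)
                (.s9 3 q _ m (by simp) hqm))))
        clear hk
        induction k with
        | zero =>
          exact .s5_succ _ _ _ _ n _ (.s5_zero _ _ _ _ (kleeneEval_projIndex rfl)) (hr _ _ _)
        | succ k ihk => exact .s5_succ _ _ _ _ m _ ihk (hr _ _ _)
  obtain ⟨m, hm, hqm⟩ := search N 0 (by rwa [Nat.zero_add])
  exact ⟨m, hm, kleeneEval_compIndex (.s2 q _) (kleeneEval_compIndex (.s2 0 _) hqm)⟩

/-! ### The finite covering test and compactness -/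

/-- The finite sequence with code `c` has length at most `n`, and its entries are the first binary
digits of `t`. -/
def DigitsExtend (c : ℕ) (p : ℕ × ℕ) : Prop :=
  (Denumerable.ofNat (List ℕ) c).length ≤ p.2 ∧
    initSeg (fun k => p.1 / 2 ^ k % 2) (Denumerable.ofNat (List ℕ) c).length =
      Denumerable.ofNat (List ℕ) c

/-- Each binary sequence of length `n` extends a sequence of length at most `n` whose code is in
the list `L`. -/
def ListCovers (n : ℕ) (L : List ℕ) : Prop :=
  ∀ t ∈ List.range (2 ^ n), ∃ c ∈ L, DigitsExtend c (t, n)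

theorem primrecRel_digitsExtend : PrimrecRel DigitsExtend := by
  have hσ : Primrec fun q : ℕ × ℕ × ℕ => Denumerable.ofNat (List ℕ) q.1 :=
    (Primrec.ofNat (List ℕ)).comp .fst
  have hlen := Primrec.list_length.comp hσ
  have hpow : Primrec₂ fun a b : ℕ => a ^ b := Primrec₂.unpaired'.1 Nat.Primrec.pow
  refine PrimrecPred.and (Primrec.nat_le.comp hlen (Primrec.snd.comp .snd))
    (Primrec.eq.comp (Primrec.list_map (Primrec.list_range.comp hlen) ?_) hσ)
  exact Primrec.nat_mod.comp (Primrec.nat_div.comp (Primrec.fst.comp (Primrec.snd.comp .fst))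
    (hpow.comp (.const 2) .snd)) (.const 2)

theorem primrecRel_listCovers : PrimrecRel ListCovers := by
  have h : PrimrecRel fun (t : ℕ) (q : List ℕ × ℕ) => ∃ c ∈ q.1, DigitsExtend c (t, q.2) :=
    primrecRel_digitsExtend.exists_mem_list.comp (Primrec.fst.comp .snd)
      (Primrec.pair .fst (Primrec.snd.comp .snd))
  have hpow : Primrec₂ fun a b : ℕ => a ^ b := Primrec₂.unpaired'.1 Nat.Primrec.pow
  exact h.forall_mem_list.comp (Primrec.list_range.comp (hpow.comp (.const 2) .fst))
    (Primrec.pair .snd .fst)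

theorem digit_mem_cantor (t : ℕ) : (fun k => t / 2 ^ k % 2) ∈ Cantor := fun k => by
  have := Nat.mod_lt (t / 2 ^ k) two_pos
  dsimp only
  omega

theorem exists_digits_eq {g : ℕ → ℕ} (hg : g ∈ Cantor) (n : ℕ) :
    ∃ t < 2 ^ n, ∀ k < n, t / 2 ^ k % 2 = g k := by
  refine ⟨Nat.ofBits fun i : Fin n => decide (g i = 1), Nat.ofBits_lt_two_pow _, fun k hk => ?_⟩
  have h := Nat.testBit_ofBits_lt (fun i : Fin n => decide (g i = 1)) k hk
  rw [Nat.testBit_eq_decide_div_mod_eq, decide_eq_decide] at h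
  have := hg k
  dsimp only at h
  omega

/-- The sequences that the test accepts have length at most `n`, so extending one depends only on
the first `n` digits of `g`, and these are the digits of some `t < 2 ^ n`. -/
theorem cantor_subset_of_listCovers {s : ℕ → ℕ} {n : ℕ} (h : ListCovers n (reverseSeg s n)) :
    Cantor ⊆ ⋃ i ∈ Finset.range n, coverSet s i := by
  intro g hg
  obtain ⟨t, ht, htg⟩ := exists_digits_eq hg n
  obtain ⟨c, hc, hlen, hseg⟩ := h t (List.mem_range.2 ht)
  obtain ⟨i, hi, rfl⟩ := mem_reverseSeg.1 hc
  refine Set.mem_biUnion (Finset.mem_coe.2 (Finset.mem_range.2 hi)) ⟨hg, ?_⟩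
  refine Eq.trans (List.map_congr_left fun k hk => ?_) hseg
  exact (htg k ((List.mem_range.1 hk).trans_le hlen)).symm

theorem isCompact_cantor : IsCompact Cantor := by
  have : Cantor = Set.univ.pi fun _ => Set.Iic 1 := by
    ext f
    simp [Cantor, Pi.le_def]
  rw [this]
  exact isCompact_univ_pi fun _ => (Set.finite_Iic 1).isCompact

theorem isOpen_initSeg_eq (σ : List ℕ) : IsOpen {g : ℕ → ℕ | initSeg g σ.length = σ} := by
  have : {g : ℕ → ℕ | initSeg g σ.length = σ} =
      ⋂ k ∈ Finset.range σ.length, (fun g : ℕ → ℕ => g k) ⁻¹' {x | σ[k]? = some x} := by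
    ext g
    simp only [initSeg, Set.mem_ofPred_eq, Finset.mem_range, Set.mem_iInter, Set.mem_preimage]
    constructor
    · intro h k hk
      rw [← h]
      simp [hk]
    · intro h
      refine List.ext_getElem (by simp) fun k _ hk => ?_
      have := h k hk
      rw [List.getElem?_eq_getElem hk, Option.some.injEq] at this
      simp [this]
  rw [this]
  exact isOpen_biInter_finset fun k _ => (isOpen_discrete _).preimage (continuous_apply k)

/-- Compactness enters only here, to show that the search terminates. -/
theorem exists_listCovers {s : ℕ → ℕ} (hs : Cantor ⊆ ⋃ i, coverSet s i) :
    ∃ n, ListCovers n (reverseSeg s n) := by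
  obtain ⟨T, hT⟩ := isCompact_cantor.elim_finite_subcover _
    (fun i => isOpen_initSeg_eq (Denumerable.ofNat (List ℕ) (s i)))
    (hs.trans (Set.iUnion_mono fun i _ hg => hg.2))
  -- The bound must exceed the indices in the finite subcover and be at least the lengths of its
  -- sequences.
  refine ⟨T.sup fun i => max (i + 1) (Denumerable.ofNat (List ℕ) (s i)).length, fun t _ => ?_⟩
  obtain ⟨i, hi, hgi⟩ := Set.mem_iUnion₂.1 (hT (digit_mem_cantor t))
  have hle := Finset.le_sup (f := fun i => max (i + 1) (Denumerable.ofNat (List ℕ) (s i)).length) hi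
  exact ⟨s i, mem_reverseSeg.2 ⟨i, (le_max_left _ _).trans hle, rfl⟩,
    (le_max_right _ _).trans hle, hgi⟩

/-- Finite subcoverings of countable coverings of Cantor space are computable. -/
theorem exists_index_subcover : ∃ e : ℕ, ∀ s : ℕ → ℕ, (Cantor ⊆ ⋃ i : ℕ, coverSet s i) →
    ∃ n : ℕ, KleeneEval e [arg1 s] n ∧ Cantor ⊆ ⋃ i ∈ Finset.range n, coverSet s i := by
  classical
  have ht : Primrec₂ fun n w : ℕ => if ListCovers n (Denumerable.ofNat (List ℕ) w) then 0 else 1 :=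
    Primrec.ite (primrecRel_listCovers.comp .fst ((Primrec.ofNat (List ℕ)).comp .snd))
      (.const 0) (.const 1)
  obtain ⟨e, he⟩ := exists_index_search ht
  refine ⟨e, fun s hs => ?_⟩
  obtain ⟨N, hN⟩ := exists_listCovers hs
  obtain ⟨n, hn, hen⟩ := he s ⟨N, by simp [hN]⟩
  refine ⟨n, hen, cantor_subset_of_listCovers ?_⟩
  simpa using hn

end Pincherle

theorem mainTheorem4 :
    (¬ ∃ (H : (ℕ → ℕ) → ℕ) (M : ((ℕ → ℕ) → ℕ) → ((ℕ → ℕ) → ℕ) → ℕ),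
        Pincherle.ComputableIn M H ∧ Pincherle.WPR M) ∧
    (∃ e : ℕ, ∀ s : ℕ → ℕ, (Pincherle.Cantor ⊆ ⋃ i : ℕ, Pincherle.coverSet s i) →
        ∃ n : ℕ, Pincherle.KleeneEval e [Pincherle.arg1 s] n ∧
          Pincherle.Cantor ⊆ ⋃ i ∈ Finset.range n, Pincherle.coverSet s i) :=
  ⟨fun ⟨_, _, hM, hW⟩ => Pincherle.not_computableIn_of_wpr hW hM, Pincherle.exists_index_subcover⟩
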